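/- Let $(\mathrm{fs})$ be the category of finite sets and bijections, and let $\mathrm{Sym}(\mathrm{Vec})$ be the category of functors $(\mathrm{fs}) \to \mathrm{Vec}$, where $\mathrm{Vec}$ is the category of complex vector spaces of arbitrary dimension, with the convolution tensor product $(V \otimes W)_L = \bigoplus_{L = A \amalg B} V_A \otimes W_B$. A *twisted commutative algebra* is a commutative, associative, unital algebra $A$ in $\mathrm{Sym}(\mathrm{Vec})$, that is, a functor $L \mapsto A_L$ with a unit $1 \in A_\emptyset$ and natural multiplication maps $A_L \otimes A_{L'} \to A_{L \amalg L'}$ satisfying the associativity, commutativity and unit identities. An *$A$-module* is an object $M$ of $\mathrm{Sym}(\mathrm{Vec})$ with natural maps $A_L \otimes M_{L'} \to M_{L \amalg L'}$ that are associative and unital. Subalgebras and submodules are families of subspaces stable under bijections and under the given operations (and, for subalgebras, containing the unit). An *element* of $V \in \mathrm{Sym}(\mathrm{Vec})$ is an element of $V_L$ for some finite set $L$, and its *order* is $\# L$. The algebra $A$ is *finitely generated in order 1* if there are finitely many elements of $A$ of order $1$ such that no proper subalgebra of $A$ contains them all. An $A$-module $M$ is *finitely generated* if there are finitely many elements of $M$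 such that no proper $A$-submodule contains them all. It is *noetherian* if every ascending chain $N_0 \subseteq N_1 \subseteq \cdots$ of $A$-submodules of $M$ stabilizes. The algebra $A$ is *noetherian* if every finitely generated $A$-module is noetherian. **Theorem.** Every twisted commutative algebra that is finitely generated in order 1 is noetherian. -/

import Mathlib

open CategoryTheory

universe u v

/-- The category `(fs)` of finite sets and bijections. -/
abbrev FinBij : Type 1 := Core FintypeCat.{0}

/-- A finite set, as an object of `(fs)`. -/
abbrev FinBij.of (L : Type) [Finite L] : FinBij := ⟨FintypeCat.of L⟩

/-- A bijection, as a morphism of `(fs)`. -/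
def FinBij.hom {L M : Type} [Finite L] [Finite M] (e : L ≃ M) : FinBij.of L ⟶ FinBij.of M :=
  ⟨FintypeCat.equivEquivIso e⟩

/-- The category `Sym(Vec)` in its standard model: functors from finite sets and bijections to
complex vector spaces (of arbitrary dimension). -/
abbrev SymVec : Type (u + 1) := FinBij ⥤ ModuleCat.{u} ℂ

namespace SymVec

/-- The value `V_L` on a finite set `L`. -/
abbrev at' (V : SymVec.{u}) (L : Type) [Finite L] : Type u := V.obj (FinBij.of L)

/-- The linear map `V_L → V_M` induced by a bijection `L ≃ M`. -/
def act (V : SymVec.{u}) {L M : Type} [Finite L] [Finite M] (e : L ≃ M) : V.at' L →ₗ[ℂ] V.at' M :=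
  (V.map (FinBij.hom e)).hom

theorem act_refl (V : SymVec.{u}) {L : Type} [Finite L] (x : V.at' L) :
    V.act (Equiv.refl L) x = x := by
  have h : FinBij.hom (Equiv.refl L) = 𝟙 (FinBij.of L) := rfl
  simp [act, h]

theorem act_trans (V : SymVec.{u}) {L M N : Type} [Finite L] [Finite M] [Finite N]
    (e : L ≃ M) (f : M ≃ N) (x : V.at' L) :
    V.act (e.trans f) x = V.act f (V.act e x) := by
  have h : FinBij.hom (e.trans f) = FinBij.hom e ≫ FinBij.hom f := rfl
  simp [act, h]

/-- An element of `V`: a finite set `L` together with an element of `V_L`. -/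
structure Elt (V : SymVec.{u}) where
  /-- the finite set -/
  set : Type
  [finite : Finite set]
  /-- the element of `V_L` -/
  val : V.at' set

attribute [instance] Elt.finite

/-- The order of an element of `V_L` is the cardinality of `L`. -/
noncomputable def Elt.order {V : SymVec.{u}} (x : V.Elt) : ℕ := Nat.card x.set

/-- A subobject of `V`: a family of subspaces stable under bijections. -/
@[ext]
structure Sub (V : SymVec.{u}) where
  /-- the subspace of `V_L` -/
  carrier : ∀ (L : Type) [Finite L], Submodule ℂ (V.at' L)
  act_mem : ∀ {L M : Type} [Finite L] [Finite M] (e : L ≃ M) {x : V.at' L},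
    x ∈ carrier L → V.act e x ∈ carrier M

end SymVec

/-- A twisted commutative algebra: a commutative, associative, unital algebra in `Sym(Vec)` for the
convolution tensor product. A multiplication map `A ⊗ A → A` is the same as a natural family of
bilinear maps `A_L × A_M → A_{L ⨿ M}`. -/
structure TCA where
  /-- the underlying object of `Sym(Vec)` -/
  toSymVec : SymVec.{u}
  /-- the unit, of order `0` -/
  one : toSymVec.at' Empty
  /-- the multiplication -/
  mul : ∀ {L M : Type} [Finite L] [Finite M],
    toSymVec.at' L →ₗ[ℂ] toSymVec.at' M →ₗ[ℂ] toSymVec.at' (L ⊕ M)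
  mul_natural : ∀ {L L' M M' : Type} [Finite L] [Finite L'] [Finite M] [Finite M']
    (e : L ≃ L') (f : M ≃ M') (x : toSymVec.at' L) (y : toSymVec.at' M),
    toSymVec.act (Equiv.sumCongr e f) (mul x y) = mul (toSymVec.act e x) (toSymVec.act f y)
  mul_assoc : ∀ {L M N : Type} [Finite L] [Finite M] [Finite N]
    (x : toSymVec.at' L) (y : toSymVec.at' M) (z : toSymVec.at' N),
    toSymVec.act (Equiv.sumAssoc L M N) (mul (mul x y) z) = mul x (mul y z)
  mul_comm : ∀ {L M : Type} [Finite L] [Finite M] (x : toSymVec.at' L) (y : toSymVec.at' M),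
    toSymVec.act (Equiv.sumComm L M) (mul x y) = mul y x
  one_mul : ∀ {L : Type} [Finite L] (x : toSymVec.at' L),
    toSymVec.act (Equiv.emptySum Empty L) (mul one x) = x

namespace TCA

/-- A subalgebra of a twisted commutative algebra. -/
structure Subalg (A : TCA.{u}) extends SymVec.Sub A.toSymVec where
  one_mem : A.one ∈ carrier Empty
  mul_mem : ∀ {L M : Type} [Finite L] [Finite M] {x : A.toSymVec.at' L} {y : A.toSymVec.at' M},
    x ∈ carrier L → y ∈ carrier M → A.mul x y ∈ carrier (L ⊕ M)

/-- `S` generates the algebra `A`: the only subalgebra containing `S` is `A`. -/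
def Generates (A : TCA.{u}) (S : Set A.toSymVec.Elt) : Prop :=
  ∀ B : A.Subalg, (∀ s ∈ S, s.val ∈ B.carrier s.set) →
    ∀ (L : Type) [Finite L] (x : A.toSymVec.at' L), x ∈ B.carrier L

/-- `A` is generated as an algebra by finitely many elements of order `1`. -/
def FinitelyGeneratedInOrderOne (A : TCA.{u}) : Prop :=
  ∃ S : Set A.toSymVec.Elt, S.Finite ∧ (∀ s ∈ S, s.order = 1) ∧ A.Generates S

/-- A module over the twisted commutative algebra `A`: an object of `Sym(Vec)` with an associative
and unital action `A ⊗ M → M`, i.e. a natural family of bilinear maps `A_K × M_L → M_{K ⨿ L}`. -/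
structure Mod (A : TCA.{u}) where
  /-- the underlying object of `Sym(Vec)` -/
  toSymVec : SymVec.{v}
  /-- the action of `A` -/
  smul : ∀ {K L : Type} [Finite K] [Finite L],
    A.toSymVec.at' K →ₗ[ℂ] toSymVec.at' L →ₗ[ℂ] toSymVec.at' (K ⊕ L)
  smul_natural : ∀ {K K' L L' : Type} [Finite K] [Finite K'] [Finite L] [Finite L']
    (e : K ≃ K') (f : L ≃ L') (a : A.toSymVec.at' K) (m : toSymVec.at' L),
    toSymVec.act (Equiv.sumCongr e f) (smul a m) = smul (A.toSymVec.act e a) (toSymVec.act f m)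
  mul_smul : ∀ {J K L : Type} [Finite J] [Finite K] [Finite L]
    (a : A.toSymVec.at' J) (b : A.toSymVec.at' K) (m : toSymVec.at' L),
    toSymVec.act (Equiv.sumAssoc J K L) (smul (A.mul a b) m) = smul a (smul b m)
  one_smul : ∀ {L : Type} [Finite L] (m : toSymVec.at' L),
    toSymVec.act (Equiv.emptySum Empty L) (smul A.one m) = m

namespace Mod

variable {A : TCA.{u}}

/-- An `A`-submodule of `M`. -/
@[ext]
structure Submod (M : Mod.{u, v} A) extends SymVec.Sub M.toSymVec where
  smul_mem : ∀ {K L : Type} [Finite K] [Finite L] (a : A.toSymVec.at' K) {m : M.toSymVec.at' L},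
    m ∈ carrier L → M.smul a m ∈ carrier (K ⊕ L)

/-- Inclusion of submodules. -/
instance (M : Mod.{u, v} A) : PartialOrder M.Submod where
  le N P := ∀ (L : Type) [Finite L], N.carrier L ≤ P.carrier L
  le_refl N L _ := le_refl (N.carrier L)
  le_trans _ _ _ h₁ h₂ L _ := le_trans (h₁ L) (h₂ L)
  le_antisymm N P h₁ h₂ := by
    ext L _ : 3
    exact le_antisymm (h₁ L) (h₂ L)

/-- `M` is generated as an `A`-module by finitely many elements. -/
def FinitelyGenerated (M : Mod.{u, v} A) : Prop :=
  ∃ S : Set M.toSymVec.Elt, S.Finite ∧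
    ∀ N : M.Submod, (∀ s ∈ S, s.val ∈ N.carrier s.set) →
      ∀ (L : Type) [Finite L] (x : M.toSymVec.at' L), x ∈ N.carrier L

/-- `M` is noetherian: every ascending chain of submodules stabilizes. -/
def IsNoetherian (M : Mod.{u, v} A) : Prop :=
  ∀ N : ℕ → M.Submod, Monotone N → ∃ n, ∀ m, n ≤ m → N m = N n

end Mod

/-- `A` is noetherian (as an algebra): every finitely generated `A`-module is noetherian. -/
def IsNoetherian (A : TCA.{u}) : Prop :=
  ∀ M : Mod.{u, v} A, M.FinitelyGenerated → M.IsNoetherian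

end TCA

/-! This is a Gröbner basis argument whose combinatorial input is Higman's lemma. If `x` lists the
generators of `A`, indexed by a finite set `D`, then commutativity makes `A_L` the span of monomials
indexed by the colourings `L → D`. Hence, if `M` has generators `m j` of shape `P j`, then `M_L` is
spanned by words: a generator, an embedding `P j ↪ L`, and a colouring of `L`
(`FinitelyGenerated.exists_span_indexElt`).

On `L = Fin n` a word is a sequence over a finite alphabet, and words are ordered lexicographically.
Multiplying by a monomial along an order embedding `Fin n ↪o Fin n'` inserts letters
(`insertMap_wordElt`), and this is strictly monotone (`insert_strictMono`). So the leading words of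
a submodule are closed under insertion. Insertion is a well quasi-order (`wellQuasiOrdered_insert`),
so the sets of leading words of an ascending chain stabilize, and nested submodules with the same
leading words agree (`Submodule.le_of_leadingIndices_subset`).

The spanning words may be linearly dependent: colours at points of the embedded `P j` do not affect
the element. Leading indices are therefore defined by existence of a representation, not by
coordinates. -/

theorem SymVec.act_act (V : SymVec.{u}) {L M N : Type} [Finite L] [Finite M] [Finite N]
    (e : L ≃ M) (f : M ≃ N) (x : V.at' L) :
    V.act f (V.act e x) = V.act (e.trans f) x :=
  (V.act_trans e f x).symm

theorem SymVec.act_congr (V : SymVec.{u}) {L M : Type} [Finite L] [Finite M]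
    {e f : L ≃ M} (h : ∀ l, e l = f l) (x : V.at' L) : V.act e x = V.act f x := by
  rw [Equiv.ext h]

/-! ### Monomials in elements of order one. -/

namespace TCA

variable (A : TCA.{u})

theorem mul_act_right {L M M' : Type} [Finite L] [Finite M] [Finite M']
    (f : M ≃ M') (x : A.toSymVec.at' L) (y : A.toSymVec.at' M) :
    A.mul x (A.toSymVec.act f y) =
      A.toSymVec.act (Equiv.sumCongr (Equiv.refl L) f) (A.mul x y) := by
  rw [A.mul_natural, SymVec.act_refl]

theorem mul_act_left {L L' M : Type} [Finite L] [Finite L'] [Finite M]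
    (e : L ≃ L') (x : A.toSymVec.at' L) (y : A.toSymVec.at' M) :
    A.mul (A.toSymVec.act e x) y =
      A.toSymVec.act (Equiv.sumCongr e (Equiv.refl M)) (A.mul x y) := by
  rw [A.mul_natural, SymVec.act_refl]

theorem mul_mul {L M N : Type} [Finite L] [Finite M] [Finite N]
    (x : A.toSymVec.at' L) (y : A.toSymVec.at' M) (z : A.toSymVec.at' N) :
    A.mul x (A.mul y z) = A.toSymVec.act (Equiv.sumAssoc L M N) (A.mul (A.mul x y) z) :=
  (A.mul_assoc x y z).symm

/-- The bijection `Unit ⊕ Fin n ≃ Fin (n + 1)` that puts the new point first. -/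
def unitSumFin (n : ℕ) : Unit ⊕ Fin n ≃ Fin (n + 1) where
  toFun := Sum.elim (fun _ => 0) Fin.succ
  invFun := Fin.cases (Sum.inl ()) Sum.inr
  left_inv := by rintro (_ | i) <;> simp
  right_inv i := by cases i using Fin.cases <;> simp

@[simp] theorem unitSumFin_inl (n : ℕ) (a : Unit) : unitSumFin n (Sum.inl a) = 0 := rfl

@[simp] theorem unitSumFin_inr (n : ℕ) (i : Fin n) : unitSumFin n (Sum.inr i) = i.succ := rfl

@[simp] theorem unitSumFin_symm_zero (n : ℕ) : (unitSumFin n).symm 0 = Sum.inl () := rfl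

@[simp] theorem unitSumFin_symm_succ (n : ℕ) (i : Fin n) :
    (unitSumFin n).symm i.succ = Sum.inr i := rfl

variable {D : Type} (x : D → A.toSymVec.at' Unit)

/-- The product of the elements `x (f i)` of order one, for `i : Fin n`. -/
def finMonomial : ∀ {n : ℕ}, (Fin n → D) → A.toSymVec.at' (Fin n)
  | 0, _ => A.toSymVec.act (Equiv.equivOfIsEmpty Empty (Fin 0)) A.one
  | n + 1, f => A.toSymVec.act (unitSumFin n) (A.mul (x (f 0)) (finMonomial fun i => f i.succ))

theorem finMonomial_succ {n : ℕ} (f : Fin (n + 1) → D) :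
    A.finMonomial x f =
      A.toSymVec.act (unitSumFin n) (A.mul (x (f 0)) (A.finMonomial x fun i => f i.succ)) :=
  rfl

/-- Adjacent transpositions permute the factors of a monomial. -/
theorem act_swap_finMonomial : ∀ {n : ℕ} (i : Fin n) (f : Fin (n + 1) → D),
    A.toSymVec.act (Equiv.swap i.castSucc i.succ) (A.finMonomial x f) =
      A.finMonomial x (f ∘ Equiv.swap i.castSucc i.succ)
  | 0, i, _ => i.elim0
  | n + 1, i, f => by
    cases i using Fin.cases with
    | zero =>
      have hs : ∀ i : Fin n, Equiv.swap (0 : Fin (n + 2)) 1 i.succ.succ = i.succ.succ := fun i =>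
        Equiv.swap_apply_of_ne_of_ne (by simp [Fin.ext_iff]) (by simp [Fin.ext_iff])
      simp only [finMonomial, Function.comp, Fin.castSucc_zero, Fin.succ_zero_eq_one,
        Equiv.swap_apply_left, Equiv.swap_apply_right, hs, mul_act_right, mul_mul,
        SymVec.act_act]
      -- Commutativity exchanges the first two factors, which associativity has grouped together.
      rw [← A.mul_comm (x (f 1)) (x (f 0)), mul_act_left, SymVec.act_act]
      refine SymVec.act_congr _ ?_ _
      rintro ((_ | _) | i) <;> simp [hs]
    | succ i =>
      have h0 : Equiv.swap i.succ.castSucc i.succ.succ 0 = 0 :=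
        Equiv.swap_apply_of_ne_of_ne (by simp [Fin.ext_iff]) (by simp [Fin.ext_iff])
      have hs : ∀ j : Fin (n + 1), Equiv.swap i.succ.castSucc i.succ.succ j.succ =
          (Equiv.swap i.castSucc i.succ j).succ := fun j => by
        have := (Fin.succ_injective _).swap_apply i.castSucc i.succ j
        rwa [Fin.succ_castSucc] at this
      have ih := act_swap_finMonomial i fun j => f j.succ
      rw [finMonomial_succ A x f, finMonomial_succ A x (f ∘ _), SymVec.act_act]
      simp only [Function.comp, h0, hs]
      simp only [Function.comp_def] at ih
      rw [← ih, mul_act_right, SymVec.act_act]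
      refine SymVec.act_congr _ ?_ _
      rintro (_ | j)
      · exact h0
      · exact hs j

/-- Adjacent transpositions generate the symmetric group. This makes `monomial` independent of the
enumeration in its definition. -/
theorem act_finMonomial {n : ℕ} (σ : Equiv.Perm (Fin n)) (f : Fin n → D) :
    A.toSymVec.act σ (A.finMonomial x (f ∘ σ)) = A.finMonomial x f := by
  cases n with
  | zero => rw [Subsingleton.elim σ (Equiv.refl _), SymVec.act_refl]; rfl
  | succ n =>
    have hσ : σ ∈ Submonoid.closure
        (Set.range fun i : Fin n => Equiv.swap i.castSucc i.succ) := by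
      rw [Equiv.Perm.mclosure_swap_castSucc_succ]; trivial
    induction hσ using Submonoid.closure_induction generalizing f with
    | mem σ h =>
      obtain ⟨i, rfl⟩ := h
      rw [act_swap_finMonomial]
      congr 1
      ext j
      simp
    | one => exact SymVec.act_refl _ _
    | mul σ τ _ _ hσ hτ =>
      have := hτ (f ∘ σ)
      rw [← hσ f, ← this, SymVec.act_act]
      rfl

variable {K K' : Type} [Finite K] [Finite K']

/-- The product of the elements `x (f k)` of order one, for `k` in a finite set `K`. -/
noncomputable def monomial (f : K → D) : A.toSymVec.at' K :=
  A.toSymVec.act (Finite.equivFin K).symm (A.finMonomial x (f ∘ (Finite.equivFin K).symm))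

theorem monomial_eq {n : ℕ} (e : Fin n ≃ K) (f : K → D) :
    A.monomial x f = A.toSymVec.act e (A.finMonomial x (f ∘ e)) := by
  obtain rfl : n = Nat.card K := by simpa using Nat.card_congr e
  rw [monomial, ← A.act_finMonomial x (e.trans (Finite.equivFin K)), SymVec.act_act]
  congr 2
  · ext; simp
  · ext; simp

theorem act_monomial (e : K ≃ K') (f : K' → D) :
    A.toSymVec.act e (A.monomial x (f ∘ e)) = A.monomial x f := by
  rw [A.monomial_eq x ((Finite.equivFin K).symm.trans e), monomial, SymVec.act_act]
  rfl

theorem mul_monomial_unit (f : Unit ⊕ K → D) :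
    A.mul (x (f (Sum.inl ()))) (A.monomial x fun k => f (Sum.inr k)) = A.monomial x f := by
  have e := (Finite.equivFin K).symm
  rw [A.monomial_eq x ((unitSumFin _).symm.trans (Equiv.sumCongr (Equiv.refl Unit) e)),
    A.monomial_eq x e, finMonomial, SymVec.act_act, mul_act_right]
  refine SymVec.act_congr _ ?_ _
  rintro (_ | k) <;> simp

theorem monomial_empty (f : Empty → D) : A.monomial x f = A.one := by
  rw [A.monomial_eq x (Equiv.equivOfIsEmpty (Fin 0) Empty), finMonomial, SymVec.act_act]
  exact (SymVec.act_congr _ (fun l : Empty => l.elim) _).trans (A.toSymVec.act_refl _)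

theorem one_mul_eq {L : Type} [Finite L] (y : A.toSymVec.at' L) :
    A.mul A.one y = A.toSymVec.act (Equiv.emptySum Empty L).symm y := by
  conv_rhs => rw [← A.one_mul y, SymVec.act_act, Equiv.self_trans_symm, SymVec.act_refl]

theorem monomial_unit (f : Unit → D) : A.monomial x f = x (f ()) := by
  let e : Unit ⊕ Empty ≃ Unit := Equiv.sumEmpty Unit Empty
  rw [← A.act_monomial x e, ← mul_monomial_unit, monomial_empty, ← A.mul_comm, one_mul_eq,
    SymVec.act_act, SymVec.act_act]
  exact (SymVec.act_congr _ (fun l => rfl) _).trans (A.toSymVec.act_refl _)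

theorem mul_finMonomial : ∀ {n : ℕ} (f : Fin n ⊕ K → D),
    A.mul (A.finMonomial x fun i => f (Sum.inl i)) (A.monomial x fun k => f (Sum.inr k)) =
      A.monomial x f
  | 0, f => by
    rw [finMonomial, mul_act_left, one_mul_eq, SymVec.act_act,
      ← A.act_monomial x ((Equiv.emptySum Empty K).symm.trans
        (Equiv.sumCongr (Equiv.equivOfIsEmpty Empty (Fin 0)) (Equiv.refl K))) f]
    rfl
  | n + 1, f => by
    have h := A.mul_assoc (x (f (Sum.inl 0))) (A.finMonomial x fun i => f (Sum.inl (Fin.succ i)))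
      (A.monomial x fun k => f (Sum.inr k))
    have ih := mul_finMonomial fun k : Fin n ⊕ K => f (Sum.map Fin.succ id k)
    simp only [Sum.map_inl, Sum.map_inr, id] at ih
    have hu := A.mul_monomial_unit x (f ∘ Sum.elim (fun _ : Unit => Sum.inl 0)
      (Sum.map (Fin.succ : Fin n → _) (id : K → K)))
    simp only [Function.comp, Sum.elim_inl, Sum.elim_inr] at hu
    rw [ih, hu] at h
    rw [finMonomial, mul_act_left, ← A.act_monomial x ((Equiv.sumAssoc Unit (Fin n) K).symm.trans
      (Equiv.sumCongr (unitSumFin n) (Equiv.refl K))) f, ← SymVec.act_act]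
    congr 1
    rw [← A.toSymVec.act_refl (A.mul _ _), ← Equiv.self_trans_symm (Equiv.sumAssoc _ _ _),
      ← SymVec.act_act, h]
    congr 2
    ext (_ | _ | _) <;> rfl

theorem mul_monomial (f : K ⊕ K' → D) :
    A.mul (A.monomial x fun k => f (Sum.inl k)) (A.monomial x fun k => f (Sum.inr k)) =
      A.monomial x f := by
  rw [monomial, mul_act_left,
    ← A.act_monomial x (Equiv.sumCongr (Finite.equivFin K).symm (Equiv.refl K')) f]
  congr 1
  exact A.mul_finMonomial x (f ∘ Equiv.sumCongr (Finite.equivFin K).symm (Equiv.refl K'))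

/-- The subalgebra spanned by the monomials. -/
noncomputable def monomialSubalg : A.Subalg where
  carrier L _ := Submodule.span ℂ (Set.range fun f : L → D => A.monomial x f)
  act_mem {L M} _ _ e y hy := by
    refine (Submodule.span_le (p := (Submodule.span ℂ _).comap (A.toSymVec.act e))).2 ?_ hy
    rintro _ ⟨f, rfl⟩
    refine Submodule.subset_span ⟨f ∘ e.symm, ?_⟩
    simp [← A.act_monomial x e, Function.comp_assoc]
  one_mem := Submodule.subset_span ⟨Empty.elim, A.monomial_empty x _⟩
  mul_mem {L M} _ _ y z hy hz := by
    refine Submodule.span_le (p := (Submodule.span ℂ _).comap (A.mul.flip z)) |>.2 ?_ hy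
    rintro _ ⟨f, rfl⟩
    refine Submodule.span_le (p := (Submodule.span ℂ _).comap (A.mul _)) |>.2 ?_ hz
    rintro _ ⟨g, rfl⟩
    exact Submodule.subset_span ⟨Sum.elim f g, (A.mul_monomial x (Sum.elim f g)).symm⟩

variable {A} in
/-- An algebra finitely generated in order one is spanned by the monomials in finitely many
elements of order one. -/
theorem FinitelyGeneratedInOrderOne.exists_span_monomial (hA : A.FinitelyGeneratedInOrderOne) :
    ∃ (D : Type) (_ : Finite D) (_ : Nonempty D) (x : D → A.toSymVec.at' Unit),
      ∀ (L : Type) [Finite L],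
        Submodule.span ℂ (Set.range fun f : L → D => A.monomial x f) = ⊤ := by
  obtain ⟨S, hS, h1, hgen⟩ := hA
  obtain ⟨d, s, -, rfl⟩ := hS.fin_param
  have e : ∀ i, Nonempty ((s i).set ≃ Unit) := fun i => by
    obtain ⟨_, ⟨a⟩⟩ := Nat.card_eq_one_iff_unique.1 (h1 _ ⟨i, rfl⟩)
    exact ⟨Equiv.ofBijective (fun _ => ()) ⟨fun _ _ _ => Subsingleton.elim _ _, fun _ => ⟨a, rfl⟩⟩⟩
  replace e := fun i => (e i).some
  -- The extra colour `none`, with value `0`, keeps `D` nonempty: module generators are spelled by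
  -- words, which need some colouring.
  let x : Option (Fin d) → A.toSymVec.at' Unit :=
    fun o => o.elim 0 fun i => A.toSymVec.act (e i) (s i).val
  refine ⟨Option (Fin d), inferInstance, inferInstance, x, fun L _ => ?_⟩
  refine (Submodule.eq_top_iff'.2 fun y => ?_)
  refine hgen (A.monomialSubalg _) ?_ L y
  rintro _ ⟨i, rfl⟩
  have h : A.toSymVec.act (e i) (s i).val ∈ (A.monomialSubalg x).carrier Unit :=
    Submodule.subset_span ⟨fun _ => some i, A.monomial_unit _ _⟩
  simpa only [SymVec.act_act, Equiv.self_trans_symm, SymVec.act_refl] using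
    (A.monomialSubalg _).act_mem (e i).symm h

end TCA

/-! ### Leading terms with respect to an ordered spanning family. -/

section Leading

variable {k V I : Type*} [Field k] [AddCommGroup V] [Module k V] [LinearOrder I]

/-- The indices `i` for which some element of `N` has leading term `e i` with respect to the
family `e`. -/
def Submodule.leadingIndices (N : Submodule k V) (e : I → V) : Set I :=
  {i | ∃ y ∈ Submodule.span k (e '' Set.Iio i), e i + y ∈ N}

theorem Submodule.leadingIndices_mono {N N' : Submodule k V} (h : N ≤ N') (e : I → V) :
    N.leadingIndices e ⊆ N'.leadingIndices e :=
  fun _ ⟨y, hy, hN⟩ => ⟨y, hy, h hN⟩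

/-- A nonzero element of the span of finitely many `e i` has a leading term. -/
theorem Submodule.exists_leading_of_mem_span (e : I → V) (s : Finset I) {x : V}
    (hx : x ∈ Submodule.span k (e '' s)) :
    x = 0 ∨ ∃ i ∈ s, ∃ c : k, c ≠ 0 ∧ ∃ y ∈ Submodule.span k (e '' Set.Iio i),
      x = c • e i + y := by
  induction s using Finset.induction_on_max generalizing x with
  | empty => left; simpa using hx
  | insert a s ha ih =>
    rw [Finset.coe_insert, Set.image_insert_eq, Submodule.mem_span_insert] at hx
    obtain ⟨c, z, hz, rfl⟩ := hx
    by_cases hc : c = 0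
    · rcases ih hz with rfl | ⟨i, hi, h⟩
      · left; simp [hc]
      · right
        exact ⟨i, Finset.mem_insert_of_mem hi, by simpa [hc] using h⟩
    · right
      exact ⟨a, Finset.mem_insert_self _ _, c, hc, z,
        Submodule.span_mono (Set.image_mono fun i hi => ha i hi) hz, rfl⟩

/-- A submodule of a module with a finite ordered generating family is determined, among the
submodules containing it, by its leading indices. -/
theorem Submodule.le_of_leadingIndices_subset [Finite I] {N N' : Submodule k V} (h : N ≤ N')
    {e : I → V} (he : Submodule.span k (Set.range e) = ⊤)
    (hN : N'.leadingIndices e ⊆ N.leadingIndices e) : N' ≤ N := by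
  have := Fintype.ofFinite I
  have key : ∀ i : I, ∀ c : k, ∀ y ∈ Submodule.span k (e '' Set.Iio i), c ≠ 0 →
      c • e i + y ∈ N' → c • e i + y ∈ N := by
    intro i
    induction i using WellFoundedLT.induction with
    | ind i ih =>
      intro c y hy hc hx
      -- Reduction step: subtracting `c • (e i + y')`, which lies in `N`, leaves an element of `N'`
      -- in the span below `i`, to which induction applies.
      obtain ⟨y', hy', hz⟩ := hN (show i ∈ N'.leadingIndices e from
        ⟨c⁻¹ • y, Submodule.smul_mem _ _ hy, by
          simpa [smul_smul, hc] using N'.smul_mem c⁻¹ hx⟩)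
      have hcz := N.smul_mem c hz
      have hd : c • e i + y = (y - c • y') + c • (e i + y') := by
        rw [smul_add]; abel
      rw [hd] at hx ⊢
      refine N.add_mem ?_ hcz
      have hx' := (N'.add_mem_iff_left (h hcz)).1 hx
      have hmem : y - c • y' ∈ Submodule.span k (e '' (Finset.univ.filter (· < i) : Finset I)) := by
        have : ((Finset.univ.filter (· < i) : Finset I) : Set I) = Set.Iio i := by ext; simp
        rw [this]
        exact Submodule.sub_mem _ hy (Submodule.smul_mem _ _ hy')
      rcases Submodule.exists_leading_of_mem_span e _ hmem with h0 | ⟨j, hj, c', hc', y'', hy'', h'⟩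
      · rw [h0]; exact N.zero_mem
      · rw [h'] at hx' ⊢
        exact ih j (by simpa using hj) c' y'' hy'' hc' hx'
  intro x hx
  have hmem : x ∈ Submodule.span k (e '' (Finset.univ : Finset I)) := by simp [he]
  rcases Submodule.exists_leading_of_mem_span e _ hmem with h0 | ⟨i, -, c, hc, y, hy, rfl⟩
  · rw [h0]; exact N.zero_mem
  · exact key i c y hy hc hx

/-- Leading indices are transported by a linear map that carries one ordered family into another
in a strictly monotone way. -/
theorem Submodule.leadingIndices_map {V' I' : Type*} [AddCommGroup V'] [Module k V']
    [LinearOrder I'] {N : Submodule k V} {N' : Submodule k V'} {e : I → V} {e' : I' → V'}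
    (T : V →ₗ[k] V') (t : I → I') (ht : StrictMono t) (hT : ∀ i, T (e i) = e' (t i))
    (hN : N ≤ N'.comap T) {i : I} (hi : i ∈ N.leadingIndices e) :
    t i ∈ N'.leadingIndices e' := by
  obtain ⟨y, hy, h⟩ := hi
  refine ⟨T y, ?_, by simpa [hT] using hN h⟩
  have := Submodule.mem_map_of_mem (f := T) hy
  rw [Submodule.map_span] at this
  refine Submodule.span_mono ?_ this
  rintro _ ⟨_, ⟨j, hj, rfl⟩, rfl⟩
  exact ⟨t j, ht hj, (hT j).symm⟩

end Leading

/-! ### Chains of upward closed sets. -/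

/-- An ascending chain of sets that are upward closed for a well quasi-order stabilizes. -/
theorem WellQuasiOrdered.exists_eq_of_monotone {α : Type*} {r : α → α → Prop}
    (hr : WellQuasiOrdered r) (U : ℕ → Set α) (hU : Monotone U)
    (hup : ∀ n a b, r a b → a ∈ U n → b ∈ U n) : ∃ n, ∀ m, n ≤ m → U m ⊆ U n := by
  by_contra! h
  choose m hm h using h
  choose a ha using fun n => Set.not_subset.1 (h n)
  -- Each `a (s i)` lies in `U (s (i + 1))` but not in `U (s i)`, so no earlier term can be related
  -- to a later one.
  let s : ℕ → ℕ := fun i => m^[i] 0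
  have hs : ∀ i, s (i + 1) = m (s i) := fun i => Function.iterate_succ_apply' m i 0
  have hsm : Monotone s := monotone_nat_of_le_succ fun i => by rw [hs]; exact hm _
  obtain ⟨i, j, hij, h⟩ := hr fun i => a (s i)
  refine (ha (s j)).2 (hup _ _ _ h (hU (hsm (Nat.succ_le_of_lt hij)) ?_))
  rw [Nat.succ_eq_add_one, hs]
  exact (ha (s i)).1

/-! ### Words, their order, and insertion of letters. -/

/-- A position in `L` for each point of one of the sets `P j`, and a colour in `D` for each
point of `L`. -/
structure WordIndex {J : Type} (P : J → Type) (D L : Type) where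
  idx : J
  pos : P idx ↪ L
  color : L → D

namespace WordIndex

variable {J : Type} {P : J → Type} {D L L' : Type}

/-- Insertion of the letters `c l`, for `l` outside the range of `g`. -/
noncomputable def insert (g : L ↪ L') (c : L' → D) (a : WordIndex P D L) : WordIndex P D L' :=
  ⟨a.idx, a.pos.trans g, Function.extend g a.color c⟩

/-- The letter at `l`: its colour, and the points placed at `l`. -/
def letter (a : WordIndex P D L) (l : L) : D × Set (Σ j, P j) :=
  (a.color l, Sigma.mk a.idx '' (a.pos ⁻¹' {l}))

/-- The letters locate every point of `P j`. Equality of indices is a separate hypothesis because an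
empty `P j` leaves no trace of `j` in the letters. -/
theorem ext_letter {a b : WordIndex P D L} (h : a.idx = b.idx) (hl : ∀ l, a.letter l = b.letter l) :
    a = b := by
  obtain ⟨j, φ, f⟩ := a
  obtain ⟨j', φ', f'⟩ := b
  obtain rfl : j = j' := h
  simp only [letter, Prod.mk.injEq] at hl
  obtain rfl : f = f' := funext fun l => (hl l).1
  congr 1
  ext p
  have : (⟨j, p⟩ : Σ j, P j) ∈ Sigma.mk j '' (φ' ⁻¹' {φ p}) := by
    rw [← (hl (φ p)).2]; exact ⟨p, rfl, rfl⟩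
  obtain ⟨p', hp', h⟩ := this
  obtain rfl : p' = p := by simpa using h
  exact hp'.symm

theorem letter_insert_apply (g : L ↪ L') (c : L' → D) (a : WordIndex P D L) (l : L) :
    (a.insert g c).letter (g l) = a.letter l := by
  refine Prod.ext (g.injective.extend_apply _ _ _) ?_
  simp only [letter, insert]
  congr 1
  ext p
  exact g.injective.eq_iff

theorem letter_insert_of_notMem (g : L ↪ L') (c : L' → D) (a : WordIndex P D L) {l : L'}
    (hl : l ∉ Set.range g) : (a.insert g c).letter l = (c l, ∅) := by
  refine Prod.ext (Function.extend_apply' _ _ _ hl) ?_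
  simp only [letter, insert, Set.image_eq_empty]
  ext p
  exact iff_of_false (fun h => hl ⟨_, h⟩) (Set.notMem_empty p)

/-- Every point of `P j` already occurs in a letter over the range of `g`, and it has only one
position, so the other letters of `b` carry a colour alone. -/
theorem eq_insert_of_letter {a : WordIndex P D L} {b : WordIndex P D L'} (h : a.idx = b.idx)
    (g : L ↪ L') (hg : ∀ l, a.letter l = b.letter (g l)) : b = a.insert g b.color := by
  refine (ext_letter h fun l => ?_).symm
  by_cases hl : l ∈ Set.range g
  · obtain ⟨l, rfl⟩ := hl
    rw [letter_insert_apply, hg]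
  · rw [letter_insert_of_notMem _ _ _ hl]
    refine Prod.ext rfl ?_
    symm
    refine Set.image_eq_empty.2 (Set.eq_empty_iff_forall_notMem.2 ?_)
    rintro p rfl
    obtain ⟨j, φ, f⟩ := a
    obtain ⟨j', φ', f'⟩ := b
    obtain rfl : j = j' := h
    have : (⟨j, p⟩ : Σ j, P j) ∈ Sigma.mk j '' (φ' ⁻¹' {g (φ p)}) :=
      (Set.ext_iff.1 (congrArg Prod.snd (hg (φ p))) ⟨j, p⟩).1 ⟨p, rfl, rfl⟩
    obtain ⟨p', hp', h⟩ := this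
    obtain rfl : p' = p := by simpa using h
    exact hl ⟨_, hp'.symm⟩

variable {r : ℕ} {P : Fin r → Type} [Finite D] [∀ j, Finite (P j)]

/-- The index of a word and the sequence of its letters, the letters being numbered. -/
noncomputable def code {n : ℕ} (a : WordIndex P D (Fin n)) :
    Fin r ×ₗ Lex (Fin n → Fin (Nat.card (D × Set (Σ j, P j)))) :=
  toLex (a.idx, toLex fun i => Finite.equivFin _ (a.letter i))

theorem code_injective {n : ℕ} :
    Function.Injective (code : WordIndex P D (Fin n) → _) := by
  intro a b h
  have h := (Prod.mk.injEq _ _ _ _).mp (toLex.injective h)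
  exact ext_letter h.1 fun l => (Finite.equivFin _).injective (congrFun (toLex.injective h.2) l)

noncomputable instance {n : ℕ} : LinearOrder (WordIndex P D (Fin n)) :=
  LinearOrder.lift' code code_injective

instance {n : ℕ} : Finite (WordIndex P D (Fin n)) :=
  Finite.of_injective (fun a => (a.idx, a.letter))
    fun _ _ h => ext_letter (congrArg Prod.fst h) (congrFun (congrArg Prod.snd h))

theorem lt_iff {n : ℕ} {a b : WordIndex P D (Fin n)} :
    a < b ↔ a.idx < b.idx ∨ a.idx = b.idx ∧ ∃ i, (∀ j < i, a.letter j = b.letter j) ∧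
      Finite.equivFin _ (a.letter i) < Finite.equivFin _ (b.letter i) := by
  change code a < code b ↔ _
  rw [code, code, Prod.Lex.toLex_lt_toLex]
  exact or_congr Iff.rfl (and_congr Iff.rfl (exists_congr fun i => and_congr
    (forall₂_congr fun j _ => (Finite.equivFin _).apply_eq_iff_eq) Iff.rfl))

/-- Both words receive the same letters at the same places, so their first difference moves from `i`
to `g i` with the two letters unchanged. -/
theorem insert_strictMono {n n' : ℕ} (g : Fin n ↪o Fin n') (c : Fin n' → D) :
    StrictMono (insert (P := P) g.toEmbedding c) := by
  intro a b h
  rw [lt_iff] at h ⊢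
  refine h.imp id fun ⟨h, i, hi, hlt⟩ => ⟨h, g i, fun j hj => ?_, ?_⟩
  · by_cases hr : j ∈ Set.range g.toEmbedding
    · obtain ⟨j, rfl⟩ := hr
      rw [letter_insert_apply, letter_insert_apply, hi j (g.lt_iff_lt.1 hj)]
    · rw [letter_insert_of_notMem _ _ _ hr, letter_insert_of_notMem _ _ _ hr]
  · have := letter_insert_apply (P := P) g.toEmbedding c
    simp only [RelEmbedding.coe_toEmbedding] at this
    rwa [this, this]

/-- Higman's lemma for words: insertion of letters is a well quasi-order. -/
theorem wellQuasiOrdered_insert :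
    WellQuasiOrdered fun a b : Σ n, WordIndex P D (Fin n) =>
      ∃ (g : Fin a.1 ↪o Fin b.1) (c : Fin b.1 → D), b.2 = a.2.insert g.toEmbedding c := by
  have hl : WellQuasiOrdered (List.SublistForall₂ (α := D × Set (Σ j, P j)) (· = ·)) := by
    have := Set.PartiallyWellOrderedOn.partiallyWellOrderedOn_sublistForall₂
      (r := (· = ·)) (Set.finite_univ (α := D × Set (Σ j, P j))).partiallyWellOrderedOn
    simpa [Set.partiallyWellOrderedOn_univ_iff] using this
  -- Indices must agree exactly; letters come from a finite alphabet, so Higman's lemma applies with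
  -- equality of letters.
  have hp := (Finite.wellQuasiOrdered (α := Fin r) (· = ·)).prod hl
  intro f
  obtain ⟨m, n, hmn, h, hs⟩ := hp fun k => ((f k).2.idx, List.ofFn (f k).2.letter)
  refine ⟨m, n, hmn, ?_⟩
  obtain ⟨l, hl, hsub⟩ := List.sublistForall₂_iff.1 hs
  rw [List.forall₂_eq_eq_eq] at hl
  subst hl
  obtain ⟨g, hg⟩ := List.sublist_iff_exists_fin_orderEmbedding_get_eq.1 hsub
  let g' : Fin (f m).1 ↪o Fin (f n).1 :=
    ((Fin.castOrderIso (List.length_ofFn)).symm.toOrderEmbedding.trans g).trans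
      (Fin.castOrderIso (List.length_ofFn)).toOrderEmbedding
  refine ⟨g', (f n).2.color, eq_insert_of_letter h _ fun i => ?_⟩
  have := hg (Fin.cast List.length_ofFn.symm i)
  simp only [List.get_ofFn] at this
  exact this

end WordIndex

/-! ### Module elements spelled by words. -/

namespace TCA.Mod

variable {A : TCA.{u}} (M : Mod.{u, v} A)

theorem smul_act_left {K K' L : Type} [Finite K] [Finite K'] [Finite L]
    (e : K ≃ K') (a : A.toSymVec.at' K) (m : M.toSymVec.at' L) :
    M.smul (A.toSymVec.act e a) m =
      M.toSymVec.act (Equiv.sumCongr e (Equiv.refl L)) (M.smul a m) := by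
  rw [M.smul_natural, SymVec.act_refl]

theorem smul_act_right {K L L' : Type} [Finite K] [Finite L] [Finite L']
    (e : L ≃ L') (a : A.toSymVec.at' K) (m : M.toSymVec.at' L) :
    M.smul a (M.toSymVec.act e m) =
      M.toSymVec.act (Equiv.sumCongr (Equiv.refl K) e) (M.smul a m) := by
  rw [M.smul_natural, SymVec.act_refl]

end TCA.Mod

/-- The bijection of `L'` with the disjoint union of `L` and the complement of its image. -/
noncomputable def complSumEquiv {L L' : Type} (g : L ↪ L') :
    {l // l ∉ Set.range g} ⊕ L ≃ L' :=
  Equiv.ofBijective (Sum.elim Subtype.val g) <| by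
    refine ⟨Function.Injective.sumElim Subtype.val_injective g.injective
      fun a b h => a.2 ⟨b, h.symm⟩, fun l => ?_⟩
    by_cases hl : l ∈ Set.range g
    · exact ⟨Sum.inr hl.choose, hl.choose_spec⟩
    · exact ⟨Sum.inl ⟨l, hl⟩, rfl⟩

namespace TCA.Mod

variable {A : TCA.{u}} (M : Mod.{u, v} A) {D : Type} (x : D → A.toSymVec.at' Unit)
  {P K L L' : Type} [Finite P] [Finite K] [Finite L] [Finite L']

/-- The product of `m`, placed at the positions `φ`, and of the elements `x (f l)` for the other
`l ∈ L`. -/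
noncomputable def wordElt (m : M.toSymVec.at' P) (φ : P ↪ L) (f : L → D) : M.toSymVec.at' L :=
  M.toSymVec.act (complSumEquiv φ) (M.smul (A.monomial x fun l => f l.1) m)

/-- Any presentation of `L` as `K ⊕ P` extending `φ` may replace the complement used in `wordElt`,
since `ψ` identifies `K` with that complement. -/
theorem act_smul_monomial (m : M.toSymVec.at' P) (φ : P ↪ L) (f : L → D) (ψ : K ⊕ P ≃ L)
    (hφ : ∀ p, ψ (Sum.inr p) = φ p) :
    M.toSymVec.act ψ (M.smul (A.monomial x fun k => f (ψ (Sum.inl k))) m) =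
      M.wordElt x m φ f := by
  let e : K ≃ {l // l ∉ Set.range φ} := Equiv.ofBijective
    (fun k => ⟨ψ (Sum.inl k), by
      rintro ⟨p, hp⟩
      rw [← hφ] at hp
      exact Sum.inr_ne_inl (ψ.injective hp)⟩) <| by
    refine ⟨fun a b h => Sum.inl_injective (ψ.injective (congrArg Subtype.val h)), ?_⟩
    rintro ⟨l, hl⟩
    obtain ⟨k | p, rfl⟩ := ψ.surjective l
    · exact ⟨k, rfl⟩
    · exact absurd ⟨p, (hφ p).symm⟩ hl
  rw [wordElt, ← A.act_monomial x e, smul_act_left, SymVec.act_act]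
  refine SymVec.act_congr _ ?_ _
  rintro (k | p)
  · rfl
  · exact hφ p

/-- Associativity merges the two monomials into one. -/
theorem smul_monomial_wordElt (m : M.toSymVec.at' P) (φ : P ↪ L) (f : L → D) (g : L ↪ L')
    (f' : L' → D) (ψ : K ⊕ L ≃ L') (hg : ∀ l, ψ (Sum.inr l) = g l) (hf : ∀ l, f' (g l) = f l) :
    M.toSymVec.act ψ (M.smul (A.monomial x fun k => f' (ψ (Sum.inl k))) (M.wordElt x m φ f)) =
      M.wordElt x m (φ.trans g) f' := by
  have h := M.mul_smul (A.monomial x fun k => f' (ψ (Sum.inl k)))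
    (A.monomial x fun l : {l // l ∉ Set.range φ} => f l.1) m
  have hmul := A.mul_monomial x
    (Sum.elim (fun k => f' (ψ (Sum.inl k))) fun l : {l // l ∉ Set.range φ} => f l.1)
  simp only [Sum.elim_inl, Sum.elim_inr] at hmul
  rw [hmul] at h
  rw [wordElt, smul_act_right, ← h, SymVec.act_act, SymVec.act_act,
    ← M.act_smul_monomial x m (φ.trans g) f' ((Equiv.sumAssoc _ _ _).trans
      ((Equiv.sumCongr (Equiv.refl K) (complSumEquiv φ)).trans ψ))]
  · congr 4
    funext k
    rcases k with k | l
    · rfl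
    · exact ((congrArg f' (hg l.1)).trans (hf l.1)).symm
  · intro p
    exact hg (φ p)

theorem act_wordElt (m : M.toSymVec.at' P) (φ : P ↪ L) (f : L → D) (e : L ≃ L') :
    M.toSymVec.act e (M.wordElt x m φ f) =
      M.wordElt x m (φ.trans e.toEmbedding) (f ∘ e.symm) := by
  rw [wordElt, SymVec.act_act, ← M.act_smul_monomial x m (φ.trans e.toEmbedding) (f ∘ e.symm)
    ((complSumEquiv φ).trans e) fun p => rfl]
  simp only [Function.comp, Equiv.trans_apply, Equiv.symm_apply_apply]
  rfl

theorem wordElt_refl (m : M.toSymVec.at' P) (f : P → D) :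
    M.wordElt x m (Function.Embedding.refl P) f = m := by
  rw [← M.act_smul_monomial x m (Function.Embedding.refl P) f (Equiv.emptySum Empty P)
    fun p => rfl, monomial_empty, one_smul]

/-- Multiplication by the monomial with factors `c l`, for `l` outside the range of `g`. -/
noncomputable def insertMap (g : L ↪ L') (c : L' → D) :
    M.toSymVec.at' L →ₗ[ℂ] M.toSymVec.at' L' :=
  M.toSymVec.act (complSumEquiv g) ∘ₗ M.smul (A.monomial x fun l => c l.1)

/-- This realizes `WordIndex.insert` by a linear map, one that preserves submodules. -/
theorem insertMap_wordElt (g : L ↪ L') (c : L' → D) (m : M.toSymVec.at' P) (φ : P ↪ L)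
    (f : L → D) :
    M.insertMap x g c (M.wordElt x m φ f) =
      M.wordElt x m (φ.trans g) (Function.extend g f c) := by
  rw [← M.smul_monomial_wordElt x m φ f g _ (complSumEquiv g) (fun l => rfl)
    fun l => g.injective.extend_apply f c l]
  simp only [insertMap, LinearMap.comp_apply]
  congr 4
  funext l
  exact (Function.extend_apply' f c _ l.2).symm

theorem Submod.insertMap_mem {M : Mod.{u, v} A} (N : M.Submod) (g : L ↪ L') (c : L' → D)
    {m : M.toSymVec.at' L} (hm : m ∈ N.carrier L) : M.insertMap x g c m ∈ N.carrier L' :=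
  N.act_mem _ (N.smul_mem _ hm)

variable {J : Type} {P : J → Type} [∀ j, Finite (P j)] (m : ∀ j, M.toSymVec.at' (P j))

/-- The element of `M` spelled by a word. -/
noncomputable def indexElt (L : Type) [Finite L] (a : WordIndex P D L) : M.toSymVec.at' L :=
  M.wordElt x (m a.idx) a.pos a.color

/-- The submodule spanned by the elements spelled by words. -/
noncomputable def wordSubmod (hx : ∀ (L : Type) [Finite L],
      Submodule.span ℂ (Set.range fun f : L → D => A.monomial x f) = ⊤) : M.Submod where
  carrier L _ := Submodule.span ℂ (Set.range (M.indexElt x m L))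
  act_mem {L L'} _ _ e y hy := by
    refine (Submodule.span_le (p := (Submodule.span ℂ _).comap (M.toSymVec.act e))).2 ?_ hy
    rintro _ ⟨a, rfl⟩
    exact Submodule.subset_span
      ⟨⟨a.idx, a.pos.trans e.toEmbedding, a.color ∘ e.symm⟩, (M.act_wordElt x _ _ _ e).symm⟩
  smul_mem {K L} _ _ b y hy := by
    have hb : b ∈ Submodule.span ℂ (Set.range fun f : K → D => A.monomial x f) := by
      rw [hx]; trivial
    refine Submodule.span_le (p := (Submodule.span ℂ _).comap (M.smul.flip y)) |>.2 ?_ hb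
    rintro _ ⟨f, rfl⟩
    refine Submodule.span_le (p := (Submodule.span ℂ _).comap (M.smul _)) |>.2 ?_ hy
    rintro _ ⟨a, rfl⟩
    refine Submodule.subset_span
      ⟨⟨a.idx, a.pos.trans Function.Embedding.inr, Sum.elim f a.color⟩, ?_⟩
    refine (M.smul_monomial_wordElt x (m a.idx) a.pos a.color Function.Embedding.inr
      (Sum.elim f a.color) (Equiv.refl (K ⊕ L)) (fun l => rfl) fun l => rfl).symm.trans ?_
    exact M.toSymVec.act_refl _

theorem FinitelyGenerated.exists_span_indexElt {M : Mod.{u, v} A} (hM : M.FinitelyGenerated)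
    [Nonempty D] (hx : ∀ (L : Type) [Finite L],
      Submodule.span ℂ (Set.range fun f : L → D => A.monomial x f) = ⊤) :
    ∃ (r : ℕ) (P : Fin r → Type) (_ : ∀ j, Finite (P j)) (m : ∀ j, M.toSymVec.at' (P j)),
      ∀ (L : Type) [Finite L], Submodule.span ℂ (Set.range (M.indexElt x m L)) = ⊤ := by
  obtain ⟨S, hS, hgen⟩ := hM
  obtain ⟨r, s, -, rfl⟩ := hS.fin_param
  refine ⟨r, fun j => (s j).set, inferInstance, fun j => (s j).val, fun L _ => ?_⟩
  refine Submodule.eq_top_iff'.2 fun y => ?_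
  refine hgen (M.wordSubmod x (fun j => (s j).val) hx) ?_ L y
  rintro _ ⟨j, rfl⟩
  exact Submodule.subset_span ⟨⟨j, Function.Embedding.refl _, fun _ => Classical.arbitrary D⟩,
    M.wordElt_refl x _ _⟩

theorem Submod.eq_of_carrier_fin_le {M : Mod.{u, v} A} {N N' : M.Submod} (h : N ≤ N')
    (h' : ∀ n, N'.carrier (Fin n) ≤ N.carrier (Fin n)) : N' = N := by
  refine le_antisymm ?_ h
  intro L _ y hy
  have := N.act_mem (Finite.equivFin L).symm (h' _ (N'.act_mem (Finite.equivFin L) hy))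
  simpa only [SymVec.act_act, Equiv.self_trans_symm, SymVec.act_refl] using this

end TCA.Mod

theorem mainTheorem4 (A : TCA.{u}) (hA : A.FinitelyGeneratedInOrderOne) :
    TCA.IsNoetherian.{u, v} A := by
  intro M hM N hN
  obtain ⟨D, _, _, x, hx⟩ := hA.exists_span_monomial
  obtain ⟨r, P, _, m, hm⟩ := hM.exists_span_indexElt x hx
  -- Words of all lengths are treated at once, so a single stage `n` serves every order.
  obtain ⟨n, hn⟩ := (WordIndex.wellQuasiOrdered_insert (P := P) (D := D)).exists_eq_of_monotone
    (fun k => {a | a.2 ∈ ((N k).carrier (Fin a.1)).leadingIndices (M.indexElt x m (Fin a.1))})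
    (fun k l hkl a ha => Submodule.leadingIndices_mono (hN hkl (Fin a.1)) _ ha) (by
      rintro k ⟨i, a⟩ ⟨j, b⟩ ⟨g, c, hb⟩ ha
      change b ∈ Submodule.leadingIndices _ _
      rw [show b = a.insert g.toEmbedding c from hb]
      exact Submodule.leadingIndices_map (M.insertMap x g.toEmbedding c) _
        (WordIndex.insert_strictMono g c) (fun a => M.insertMap_wordElt x g.toEmbedding c _ _ _)
        (fun y hy => (N k).insertMap_mem x g.toEmbedding c hy) ha)
  refine ⟨n, fun k hk => TCA.Mod.Submod.eq_of_carrier_fin_le (hN hk) fun i => ?_⟩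
  exact Submodule.le_of_leadingIndices_subset (hN hk (Fin i)) (hm (Fin i))
    fun a ha => hn k hk (show (⟨i, a⟩ : Σ n, WordIndex P D (Fin n)) ∈ _ from ha)
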